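/- Let $2=\{0,1\}$ be discrete and let ${}^\omega 2$ be the Cantor set with the product topology. A filter $D$ on $\omega$ is called nowhere dense if for every function $f:\omega\to{}^\omega 2$ there is $A\in D$ such that $f(A)$ is nowhere dense in ${}^\omega 2$. A Boolean algebra $\mathbb B$ is $\sigma$-centered if $\mathbb B\setminus\{0\}=\bigcup_{n<\omega}A_n$, where each $A_n$ is directed, i.e. for all $p,q\in A_n$ there is $r\in A_n$ with $r\le p$ and $r\le q$. A subalgebra $\mathbb S$ of $\mathbb B$ is regular if, for every $X\subseteq\mathbb S$, $\sup_{\mathbb S}X=1$ implies $\sup_{\mathbb B}X=1$. Theorem 1. There exists a nontrivial, atomless, complete, $\sigma$-centered Boolean algebra that has no countable atomless regular subalgebra (atomless meaning without atoms in its own order) if and only if there exists a nonprincipal nowhere dense ultrafilter on $\omega$. -/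

import Mathlib

universe u

/-- A Boolean algebra (or any poset with a least element) is atomless if it has no atoms. -/
def Atomless (B : Type u) [PartialOrder B] [OrderBot B] : Prop :=
  ∀ b : B, ¬ IsAtom b

/-- A Boolean algebra is `σ`-centered if its nonzero elements form a union of countably many
sets, each directed: any two members of one set have a common nonzero lower bound in that set. -/
def SigmaCentered (B : Type u) [BooleanAlgebra B] : Prop :=
  ∃ A : ℕ → Set B, (⋃ n, A n) = {b : B | b ≠ ⊥} ∧ ∀ n, DirectedOn (· ≥ ·) (A n)

/-- A subalgebra `S` of a Boolean algebra `B` is regular if every `X ⊆ S` whose supremum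
computed in `S` is `1` also has supremum `1` in `B`. -/
def RegularSubalgebra {B : Type u} [BooleanAlgebra B] (S : BooleanSubalgebra B) : Prop :=
  ∀ X : Set S, IsLUB X (⊤ : S) → IsLUB ((fun s : S => (s : B)) '' X) (⊤ : B)

/-- A filter `D` on `ω` is nowhere dense if every map from `ω` to the Cantor set sends some
member of `D` to a nowhere dense set. -/
def NowhereDenseFilter (D : Filter ℕ) : Prop :=
  ∀ f : ℕ → (ℕ → Bool), ∃ A ∈ D, IsNowhereDense (f '' A)

/-! Forward direction, by contraposition. A `σ`-centered algebra is represented by countably many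
ultrafilters, the points, such that every nonzero element lies in one (`SigmaCentered.exists_hom`).
If no nonprincipal ultrafilter on `ℕ` is nowhere dense, each element `c` is partitioned so that some
point leaves every piece. That point induces a nonprincipal ultrafilter on the indices, hence a map
`f` sending all its members to somewhere dense sets. Iterating gives a tree of partitions, with `f`
labelling the nodes by shrinking cylinders and thus naming a real. Every point leaves the tree at
some node, so every nonzero element leaves this real generic over some open set
(`isGeneric_iterTree`): it is a Cohen real, and the values of finitely determined sets form the
required subalgebra.

Converse. For a nowhere dense ultrafilter, topologize the finite sequences by letting a set be open
when it contains almost all successors of each of its nodes. The clopen algebra is complete, and its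
nodes witness `σ`-centeredness. A countable atomless subalgebra induces a continuous map `g` from
nodes to the Cantor set. Some open `W` containing the root has nowhere dense image
(`exists_open_isNowhereDense_image`), so the members of the subalgebra missing `W` have supremum `1`
there but not in the whole algebra. -/

open Set PiNat Function

/-! ### Nowhere dense sets in the Cantor space -/

theorem isNowhereDense_iff_cylinder {F : Set (ℕ → Bool)} :
    IsNowhereDense F ↔
      ∀ x n, ∃ y m, n ≤ m ∧ y ∈ cylinder x n ∧ Disjoint F (cylinder y m) := by
  constructor
  · intro h x n
    have : ¬ cylinder x n ⊆ closure F := fun hs => by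
      have hx := (interior_maximal hs (isOpen_cylinder _ x n)) (self_mem_cylinder x n)
      rw [h] at hx
      exact hx
    obtain ⟨y, hy, hyF⟩ := not_subset.1 this
    obtain ⟨m, hm⟩ := exists_disjoint_cylinder isClosed_closure hyF
    exact ⟨y, max n m, le_max_left _ _, hy,
      hm.mono subset_closure (cylinder_anti _ (le_max_right _ _))⟩
  · intro h
    refine eq_empty_iff_forall_notMem.2 fun x hx => ?_
    obtain ⟨_, ⟨z, n, rfl⟩, hxz, hz⟩ :=
      (isTopologicalBasis_cylinders (fun _ => Bool)).exists_subset_of_mem_open hx isOpen_interior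
    obtain ⟨y, m, -, hy, hd⟩ := h z n
    obtain ⟨w, hw, hwF⟩ := mem_closure_iff.1 (interior_subset (hz hy)) _
      (isOpen_cylinder _ y m) (self_mem_cylinder y m)
    exact disjoint_left.1 hd hwF hw

theorem exists_cylinder_subset {O : Set (ℕ → Bool)} (hO : IsOpen O) {x : ℕ → Bool} (hx : x ∈ O) :
    ∃ n, cylinder x n ⊆ O := by
  obtain ⟨_, ⟨z, n, rfl⟩, hxz, hz⟩ :=
    (isTopologicalBasis_cylinders (fun _ => Bool)).exists_subset_of_mem_open hx hO
  exact ⟨n, (mem_cylinder_iff_eq.1 hxz).trans_subset hz⟩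

theorem exists_disjoint_cylinders (x : ℕ → Bool) (n : ℕ) :
    ∃ y ∈ cylinder x n, ∃ z ∈ cylinder x n, Disjoint (cylinder y (n + 1)) (cylinder z (n + 1)) := by
  refine ⟨_, update_mem_cylinder x n true, _, update_mem_cylinder x n false,
    disjoint_left.2 fun w hw hw' => ?_⟩
  have h1 := hw n n.lt_succ_self
  have h2 := hw' n n.lt_succ_self
  simp_all

/-- A set dense in an open set meets every open subset of it outside any finite set. -/
theorem exists_mem_cylinder_of_subset_closure {f : ℕ → ℕ → Bool} {A : Set ℕ} {z : ℕ → Bool} {l : ℕ}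
    (h : cylinder z l ⊆ closure (f '' A)) : ∃ k ∈ A, l ≤ k ∧ f k ∈ cylinder z l := by
  have hfin : (f '' {k | k < l}).Finite := (finite_lt_nat l).image f
  -- Infinitely many points: follow `z` below `l`, then put a single `true` at place `l + n`.
  have hinf : (cylinder z l).Infinite := by
    have : Injective fun (n : ℕ) (i : ℕ) => if i < l then z i else decide (i = l + n) := by
      intro n m hnm
      have := congrFun hnm (l + n)
      simpa using this
    refine (infinite_range_of_injective this).mono ?_
    rintro _ ⟨n, rfl⟩ i hi
    simp [hi]
  obtain ⟨w, hw, hwf⟩ := (hinf.sdiff hfin).nonempty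
  obtain ⟨_, ⟨hv, hvf⟩, ⟨k, hk, rfl⟩⟩ := mem_closure_iff.1 (h hw)
    (cylinder z l \ f '' {k | k < l}) ((isOpen_cylinder _ z l).sdiff hfin.isClosed) ⟨hw, hwf⟩
  exact ⟨k, hk, not_lt.1 fun hkl => hvf ⟨k, hkl, rfl⟩, hv⟩

/-! ### Countable dense sets of ultrafilters -/

/-- A `σ`-centered algebra is an algebra of subsets of `ℕ`: the points are ultrafilters extending
the members of a centered decomposition. -/
theorem SigmaCentered.exists_hom {B : Type u} [BooleanAlgebra B] [Nontrivial B]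
    (h : SigmaCentered B) :
    ∃ e : BoundedLatticeHom B (Set ℕ), ∀ b, b ≠ ⊥ → (e b).Nonempty := by
  obtain ⟨A, hA, hdir⟩ := h
  have hbot : ∀ n, ∀ a ∈ A n, a ≠ ⊥ := fun n a ha => hA.subset (mem_iUnion_of_mem n ha)
  have key : ∀ n, ∃ J : Order.Ideal B, J.IsPrime ∧ ∀ a ∈ A n, a ∉ J := by
    intro n
    -- The clause `b = ⊤` keeps the filter nonempty when `A n` is empty.
    have hF : Order.IsPFilter {b : B | b = ⊤ ∨ ∃ a ∈ A n, a ≤ b} := by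
      refine Order.IsPFilter.of_def ⟨⊤, Or.inl rfl⟩ ?_ ?_
      · rintro x hx y hy
        rcases hx with rfl | ⟨a, ha, hax⟩
        · exact ⟨y, hy, le_top, le_rfl⟩
        rcases hy with rfl | ⟨b, hb, hby⟩
        · exact ⟨x, Or.inr ⟨a, ha, hax⟩, le_rfl, le_top⟩
        obtain ⟨c, hc, hca, hcb⟩ := hdir n a ha b hb
        exact ⟨c, Or.inr ⟨c, hc, le_rfl⟩, le_trans hca hax, le_trans hcb hby⟩
      · rintro x y hxy (rfl | ⟨a, ha, hax⟩)
        · exact Or.inl (top_le_iff.1 hxy)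
        · exact Or.inr ⟨a, ha, hax.trans hxy⟩
    have hd : Disjoint (hF.toPFilter : Set B) ((Order.Ideal.principal ⊥ : Order.Ideal B) : Set B) := by
      rw [disjoint_left]
      intro x hx hx'
      obtain rfl : x = ⊥ := le_bot_iff.1 hx'
      rcases hx with hx | ⟨a, ha, hax⟩
      · exact bot_ne_top hx
      · exact hbot n a ha (le_bot_iff.1 hax)
    obtain ⟨J, hJ, -, hJF⟩ := DistribLattice.prime_ideal_of_disjoint_filter_ideal hd
    exact ⟨J, hJ, fun a ha => disjoint_left.1 hJF (Or.inr ⟨a, ha, le_rfl⟩)⟩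
  choose J hJ hJA using key
  refine ⟨{ toFun := fun b => {n | b ∉ J n}
            map_sup' := fun a b => ?_
            map_inf' := fun a b => ?_
            map_top' := ?_
            map_bot' := ?_ }, fun b hb => ?_⟩
  · ext n
    simp only [mem_ofPred_eq, Order.Ideal.sup_mem_iff, sup_eq_union, mem_union]
    tauto
  · ext n
    simp only [mem_ofPred_eq, inf_eq_inter, mem_inter_iff]
    refine ⟨fun h => ⟨fun ha => h ((J n).lower inf_le_left ha),
      fun hb => h ((J n).lower inf_le_right hb)⟩, fun h hab => ?_⟩
    rcases (hJ n).mem_or_mem hab with h' | h'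
    exacts [h.1 h', h.2 h']
  · ext n
    simpa using (hJ n).toIsProper.top_notMem
  · ext n
    simp
  · obtain ⟨n, hn⟩ := mem_iUnion.1 (hA.symm.subset hb)
    exact ⟨n, hJA n b hn⟩

section Split

variable {B : Type u} [CompleteBooleanAlgebra B]

theorem biSup_inf_biSup_of_pairwise_disjoint {ι : Type*} {b : ι → B} (hb : Pairwise (Disjoint on b))
    (s t : Set ι) : (⨆ k ∈ s, b k) ⊓ (⨆ k ∈ t, b k) = ⨆ k ∈ s ∩ t, b k := by
  apply le_antisymm
  · simp only [iSup_inf_eq, inf_iSup_eq]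
    refine iSup₂_le fun i hi => iSup₂_le fun j hj => ?_
    by_cases hij : j = i
    · subst hij
      exact inf_le_left.trans (le_biSup b (⟨hj, hi⟩ : j ∈ s ∩ t))
    · exact ((hb hij).eq_bot.trans_le bot_le)
  · exact le_inf (biSup_mono fun _ h => h.1) (biSup_mono fun _ h => h.2)

variable (e : BoundedLatticeHom B (Set ℕ))

/-- A point outside every member of a partition induces a nonprincipal ultrafilter on the set of
indices. -/
theorem exists_ultrafilter_of_partition {b : ℕ → B} (hb : Pairwise (Disjoint on b)) {n : ℕ}
    (hn : n ∈ e (⨆ k, b k)) (hnb : ∀ k, n ∉ e (b k)) :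
    ∃ U : Ultrafilter ℕ, (∀ k, U ≠ pure k) ∧ ∀ A : Set ℕ, A ∈ U ↔ n ∈ e (⨆ k ∈ A, b k) := by
  have hmono : Monotone e := OrderHomClass.mono e
  have hinter : ∀ s t : Set ℕ, n ∈ e (⨆ k ∈ s, b k) → n ∈ e (⨆ k ∈ t, b k) →
      n ∈ e (⨆ k ∈ s ∩ t, b k) := fun s t hs ht => by
    rw [← biSup_inf_biSup_of_pairwise_disjoint hb, map_inf]
    exact ⟨hs, ht⟩
  let F : Filter ℕ :=
    { sets := {A | n ∈ e (⨆ k ∈ A, b k)}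
      univ_sets := by simpa using hn
      sets_of_superset := fun hs hst => hmono (biSup_mono fun _ h => hst h) hs
      inter_sets := fun {s t} hs ht => hinter s t hs ht }
  have hF : ∀ A : Set ℕ, A ∈ F ↔ n ∈ e (⨆ k ∈ A, b k) := fun A => Iff.rfl
  refine ⟨Ultrafilter.ofComplNotMemIff F fun s => ?_, fun k hk => ?_, hF⟩
  · rw [hF, hF]
    constructor
    · intro h
      have h2 : n ∈ e ((⨆ k ∈ s, b k) ⊔ ⨆ k ∈ sᶜ, b k) := by
        rw [← iSup_union, union_compl_self]
        simpa using hn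
      rw [map_sup] at h2
      exact h2.resolve_right h
    · intro h h'
      have := hinter _ _ h h'
      simp at this
  · have : ({k} : Set ℕ) ∈ (pure k : Ultrafilter ℕ) := Ultrafilter.mem_pure.2 rfl
    rw [← hk] at this
    have h2 : n ∈ e (⨆ j ∈ ({k} : Set ℕ), b j) := this
    rw [iSup_singleton] at h2
    exact hnb k h2

/-- Each point `m` differing from `n₀` as an ultrafilter is separated from it by some `d m`;
disjointifying the `c ⊓ d m` gives the pieces. Nothing is left over: every nonzero part of a
remainder would belong to the ultrafilter of `n₀`, making the remainder an atom. -/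
theorem exists_partition_avoiding (hB : Atomless B) (he : ∀ b, b ≠ ⊥ → (e b).Nonempty) (c : B)
    (n₀ : ℕ) :
    ∃ b : ℕ → B, Pairwise (Disjoint on b) ∧ ⨆ k, b k = c ∧ (∀ k, n₀ ∉ e (b k)) ∧
      ∀ m ∈ e c, (∀ k, m ∉ e (b k)) → ∀ a, m ∈ e a ↔ n₀ ∈ e a := by
  have hmono : Monotone e := OrderHomClass.mono e
  have hd : ∀ m, ∃ d : B, n₀ ∉ e d ∧ (m ∉ e d → ∀ a, m ∈ e a ↔ n₀ ∈ e a) := by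
    intro m
    by_cases h : ∀ a, m ∈ e a ↔ n₀ ∈ e a
    · exact ⟨⊥, by simp, fun _ => h⟩
    · push Not at h
      obtain ⟨a, ⟨h1, h2⟩ | ⟨h1, h2⟩⟩ := h
      · exact ⟨a, h2, fun h => absurd h1 h⟩
      · refine ⟨aᶜ, ?_, fun h => absurd ?_ h⟩
        · rw [map_compl']; simpa using h2
        · rw [map_compl']; exact h1
  choose d hd₀ hd using hd
  let b := disjointed fun k => c ⊓ d k
  have hb : ∀ k, b k ≤ c ⊓ d k := disjointed_le _
  have hcov : ∀ m ∈ e c, (∀ k, m ∉ e (b k)) → ∀ a, m ∈ e a ↔ n₀ ∈ e a := by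
    intro m hm hmb
    refine hd m fun hmd => ?_
    have hex : ∃ k, m ∈ e (c ⊓ d k) := ⟨m, by rw [map_inf]; exact ⟨hm, hmd⟩⟩
    classical
    refine hmb (Nat.find hex) ?_
    have : b (Nat.find hex) = _ := disjointed_apply _ _
    rw [this, map_sdiff', map_finset_sup]
    refine ⟨Nat.find_spec hex, fun hmem => ?_⟩
    rw [Finset.sup_set_eq_biUnion] at hmem
    simp only [Finset.mem_Iio, mem_iUnion, exists_prop, Function.comp] at hmem
    obtain ⟨i, hi, hi'⟩ := hmem
    exact Nat.find_min hex hi hi'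
  have hle : ⨆ k, b k ≤ c := iSup_le fun k => (hb k).trans inf_le_left
  refine ⟨b, disjoint_disjointed _, hle.antisymm ?_, fun k hk => ?_, hcov⟩
  · by_contra hcb
    refine hB (c \ ⨆ k, b k) ⟨fun h => hcb (sdiff_eq_bot_iff.1 h), fun a ha => ?_⟩
    have hpt : ∀ a' ≤ c \ ⨆ k, b k, a' ≠ ⊥ → n₀ ∈ e a' := by
      intro a' ha' hne
      obtain ⟨m, hm⟩ := he a' hne
      have hm' := hmono ha' hm
      rw [map_sdiff'] at hm'
      exact (hcov m hm'.1 (fun k hk => hm'.2 (hmono (le_iSup b k) hk)) a').1 hm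
    by_contra hne
    have h1 := hpt a ha.le hne
    have h2 := hpt ((c \ ⨆ k, b k) \ a) sdiff_le fun h => ha.not_ge (sdiff_eq_bot_iff.1 h)
    rw [map_sdiff'] at h2
    exact h2.2 h1
  · have := hmono ((hb k).trans inf_le_right) hk
    exact hd₀ k this

/-- The avoided point is the least one in `e c`, so that iteration eventually drops every point. All
uncovered points define the same ultrafilter, so a single `f` serves them all. -/
theorem exists_partition_not_nowhereDense (hB : Atomless B) (he : ∀ b, b ≠ ⊥ → (e b).Nonempty)
    (hU : ∀ U : Ultrafilter ℕ, (∀ n, U ≠ pure n) → ¬ NowhereDenseFilter (U : Filter ℕ)) (c : B) :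
    ∃ (b : ℕ → B) (f : ℕ → ℕ → Bool), Pairwise (Disjoint on b) ∧ ⨆ k, b k = c ∧
      (∀ n ∈ e c, (∀ m < n, m ∉ e c) → ∀ k, n ∉ e (b k)) ∧
      ∀ n ∈ e c, (∀ k, n ∉ e (b k)) → ∀ A : Set ℕ, n ∈ e (⨆ k ∈ A, b k) →
        ¬ IsNowhereDense (f '' A) := by
  by_cases hc : ∃ n, n ∈ e c
  · classical
    obtain ⟨b, hb, hsup, hn₀, hcov⟩ := exists_partition_avoiding e hB he c (Nat.find hc)
    obtain ⟨U, hU', hUe⟩ := exists_ultrafilter_of_partition e hb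
      (by rw [hsup]; exact Nat.find_spec hc) hn₀
    have := hU U hU'
    unfold NowhereDenseFilter at this
    push Not at this
    obtain ⟨f, hf⟩ := this
    refine ⟨b, f, hb, hsup, fun n hn hmin k => ?_, fun n hn hnb A hA => hf A ?_⟩
    · obtain rfl : n = Nat.find hc :=
        ((Nat.find_eq_iff hc).2 ⟨hn, fun m hm => hmin m hm⟩).symm
      exact hn₀ k
    · exact (hUe A).2 ((hcov n hn hnb _).1 hA)
  · push Not at hc
    have : c = ⊥ := by
      by_contra h
      exact (he c h).elim hc
    subst this
    exact ⟨fun _ => ⊥, fun _ _ => false, fun _ _ _ => disjoint_bot_left, by simp,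
      fun n hn => absurd hn (hc n), fun n hn => absurd hn (hc n)⟩

end Split

/-! ### Trees of partitions labelled by cylinders -/

/-- A tree of successive partitions of unity in `B`, together with a labelling of its nodes by
cylinders of the Cantor space that shrink along the branches. The node `k :: s` is the `k`-th
successor of `s`. -/
structure CylinderTree (B : Type u) [CompleteBooleanAlgebra B] where
  node : List ℕ → B
  pt : List ℕ → ℕ → Bool
  len : List ℕ → ℕ
  node_nil : node [] = ⊤
  pairwise_disjoint : ∀ s, Pairwise (Disjoint on fun k => node (k :: s))
  iSup_node : ∀ s, ⨆ k, node (k :: s) = node s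
  pt_mem : ∀ k s, pt (k :: s) ∈ cylinder (pt s) (len s)
  len_lt : ∀ k s, len s < len (k :: s)

/-- A set of sequences that depends on finitely many coordinates only. -/
def FinitelyDetermined (C : Set (ℕ → Bool)) : Prop :=
  ∃ j, ∀ x ∈ C, cylinder x j ⊆ C

namespace FinitelyDetermined

variable {C C' : Set (ℕ → Bool)}

theorem isOpen (h : FinitelyDetermined C) : IsOpen C := by
  obtain ⟨j, hj⟩ := h
  exact isOpen_iff_forall_mem_open.2 fun x hx =>
    ⟨cylinder x j, hj x hx, isOpen_cylinder _ x j, self_mem_cylinder x j⟩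

theorem compl (h : FinitelyDetermined C) : FinitelyDetermined Cᶜ := by
  obtain ⟨j, hj⟩ := h
  exact ⟨j, fun x hx y hy hyC => hx (hj y hyC ((mem_cylinder_comm x y j).1 hy))⟩

theorem inter (h : FinitelyDetermined C) (h' : FinitelyDetermined C') :
    FinitelyDetermined (C ∩ C') := by
  obtain ⟨j, hj⟩ := h
  obtain ⟨i, hi⟩ := h'
  exact ⟨max j i, fun x hx => subset_inter
    ((cylinder_anti x (le_max_left _ _)).trans (hj x hx.1))
    ((cylinder_anti x (le_max_right _ _)).trans (hi x hx.2))⟩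

theorem empty : FinitelyDetermined (∅ : Set (ℕ → Bool)) := ⟨0, fun _ h => h.elim⟩

theorem cylinder (x : ℕ → Bool) (n : ℕ) : FinitelyDetermined (cylinder x n) :=
  ⟨n, fun _ hy => (mem_cylinder_iff_eq.1 hy).subset⟩

theorem countable : {C | FinitelyDetermined C}.Countable := by
  refine (countable_range fun p : Σ j, Set (Fin j → Bool) =>
    {x : ℕ → Bool | (fun i : Fin p.1 => x i) ∈ p.2}).mono ?_
  rintro C ⟨j, hj⟩
  refine ⟨⟨j, (fun x (i : Fin j) => x i) '' C⟩, ?_⟩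
  ext x
  constructor
  · rintro ⟨y, hy, hyx⟩
    exact hj y hy fun i hi => (congrFun hyx ⟨i, hi⟩).symm
  · exact fun hx => ⟨x, hx, rfl⟩

end FinitelyDetermined

/-! ### Boolean values for the real named by a tree -/

namespace CylinderTree

variable {B : Type u} [CompleteBooleanAlgebra B] (T : CylinderTree B)

/-- The cylinder labelling a node. -/
def cyl (s : List ℕ) : Set (ℕ → Bool) := cylinder (T.pt s) (T.len s)

/-- The Boolean value of the statement that the generic real lies in `C`. -/
def value (C : Set (ℕ → Bool)) : B := ⨆ (s : List ℕ) (_ : T.cyl s ⊆ C), T.node s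

theorem node_cons_le (k : ℕ) (s : List ℕ) : T.node (k :: s) ≤ T.node s :=
  (le_iSup (fun k => T.node (k :: s)) k).trans (T.iSup_node s).le

theorem cyl_cons_subset (k : ℕ) (s : List ℕ) : T.cyl (k :: s) ⊆ T.cyl s :=
  (cylinder_anti _ (T.len_lt k s).le).trans (mem_cylinder_iff_eq.1 (T.pt_mem k s)).subset

theorem node_append_le (t s : List ℕ) : T.node (t ++ s) ≤ T.node s := by
  induction t with
  | nil => exact le_rfl
  | cons k t ih => exact (T.node_cons_le k (t ++ s)).trans ih

theorem cyl_append_subset (t s : List ℕ) : T.cyl (t ++ s) ⊆ T.cyl s := by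
  induction t with
  | nil => exact Subset.rfl
  | cons k t ih => exact (T.cyl_cons_subset k (t ++ s)).trans ih

theorem disjoint_node_of_length_eq {s t : List ℕ} (hl : s.length = t.length) (hst : s ≠ t) :
    Disjoint (T.node s) (T.node t) := by
  induction s generalizing t with
  | nil => exact absurd (List.length_eq_zero_iff.1 hl.symm).symm hst
  | cons k s ih =>
    cases t with
    | nil => simp at hl
    | cons l t =>
      by_cases h : s = t
      · subst h
        exact T.pairwise_disjoint s fun hkl => hst (by rw [hkl])
      · exact (ih (by simpa using hl) h).mono (T.node_cons_le _ _) (T.node_cons_le _ _)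

theorem disjoint_or_isSuffix (s t : List ℕ) (hl : s.length ≤ t.length) :
    Disjoint (T.node s) (T.node t) ∨ ∃ u, t = u ++ s := by
  have ht := List.take_append_drop (t.length - s.length) t
  by_cases h : s = t.drop (t.length - s.length)
  · exact Or.inr ⟨t.take (t.length - s.length), by rw [← h] at ht; exact ht.symm⟩
  · refine Or.inl ((T.disjoint_node_of_length_eq ?_ h).mono_right ?_)
    · rw [List.length_drop]; omega
    · conv_lhs => rw [← ht]
      exact T.node_append_le _ _

theorem length_le_len (s : List ℕ) : s.length ≤ T.len s := by
  induction s with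
  | nil => exact Nat.zero_le _
  | cons k s ih => exact Nat.succ_le_of_lt (ih.trans_lt (T.len_lt k s))

theorem iSup_node_of_length (j : ℕ) : ⨆ (s : List ℕ) (_ : s.length = j), T.node s = ⊤ := by
  induction j with
  | zero => exact top_le_iff.1 (T.node_nil.ge.trans (le_iSup₂_of_le [] rfl le_rfl))
  | succ j ih =>
    refine top_le_iff.1 (ih.ge.trans (iSup₂_le fun s hs => ?_))
    rw [← T.iSup_node s]
    exact iSup_le fun k => le_iSup₂_of_le (k :: s) (by simp [hs]) le_rfl

theorem node_le_value {s : List ℕ} {C : Set (ℕ → Bool)} (h : T.cyl s ⊆ C) :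
    T.node s ≤ T.value C :=
  le_iSup₂_of_le s h le_rfl

theorem value_mono {C C' : Set (ℕ → Bool)} (h : C ⊆ C') : T.value C ≤ T.value C' :=
  iSup₂_le fun _ hs => T.node_le_value (hs.trans h)

theorem value_empty : T.value ∅ = ⊥ :=
  le_bot_iff.1 (iSup₂_le fun s hs => (hs (self_mem_cylinder (T.pt s) (T.len s))).elim)

theorem node_inf_node_le {s t : List ℕ} {C : Set (ℕ → Bool)} (h : T.cyl s ∩ T.cyl t ⊆ C) :
    T.node s ⊓ T.node t ≤ T.value C := by
  wlog hl : s.length ≤ t.length generalizing s t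
  · rw [inf_comm]
    exact this (by rwa [inter_comm]) (le_of_not_ge hl)
  rcases T.disjoint_or_isSuffix s t hl with hd | ⟨u, rfl⟩
  · exact hd.eq_bot.trans_le bot_le
  · refine inf_le_right.trans (T.node_le_value ?_)
    exact (subset_inter (T.cyl_append_subset u s) Subset.rfl).trans h

theorem value_inter (C C' : Set (ℕ → Bool)) : T.value (C ∩ C') = T.value C ⊓ T.value C' := by
  apply le_antisymm
  · exact le_inf (T.value_mono inter_subset_left) (T.value_mono inter_subset_right)
  · unfold value
    simp only [iSup_inf_eq, inf_iSup_eq]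
    refine iSup₂_le fun s hs => iSup₂_le fun t ht => ?_
    exact T.node_inf_node_le (inter_subset_inter ht hs)

/-- Labels at depth `j` have length at least `j`, so nodes of that depth, which cover `⊤`, already
decide `C`. -/
theorem value_compl {C : Set (ℕ → Bool)} (hC : FinitelyDetermined C) :
    T.value Cᶜ = (T.value C)ᶜ := by
  refine (IsCompl.compl_eq ⟨?_, ?_⟩).symm
  · rw [disjoint_iff, ← T.value_inter, inter_compl_self, T.value_empty]
  · rw [codisjoint_iff_le_sup]
    obtain ⟨j, hj⟩ := hC
    refine (T.iSup_node_of_length j).ge.trans (iSup₂_le fun s hs => ?_)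
    have hsub : T.cyl s ⊆ cylinder (T.pt s) j := cylinder_anti _ (hs ▸ T.length_le_len s)
    by_cases h : T.pt s ∈ C
    · exact le_sup_of_le_left (T.node_le_value (hsub.trans (hj _ h)))
    · refine le_sup_of_le_right (T.node_le_value (hsub.trans fun y hy hyC => h ?_))
      exact hj y hyC ((mem_cylinder_comm _ _ _).1 hy)

/-- The subalgebra of the Boolean values of the finitely determined sets. -/
def subalgebra : BooleanSubalgebra B where
  carrier := {b | ∃ C, FinitelyDetermined C ∧ T.value C = b}
  infClosed' := by
    rintro _ ⟨C, hC, rfl⟩ _ ⟨C', hC', rfl⟩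
    exact ⟨C ∩ C', hC.inter hC', T.value_inter C C'⟩
  supClosed' := by
    rintro _ ⟨C, hC, rfl⟩ _ ⟨C', hC', rfl⟩
    refine ⟨(Cᶜ ∩ C'ᶜ)ᶜ, (hC.compl.inter hC'.compl).compl, ?_⟩
    rw [T.value_compl (hC.compl.inter hC'.compl), T.value_inter, T.value_compl hC,
      T.value_compl hC', compl_inf, compl_compl, compl_compl]
  compl_mem' := by
    rintro _ ⟨C, hC, rfl⟩
    exact ⟨Cᶜ, hC.compl, T.value_compl hC⟩
  bot_mem' := ⟨∅, .empty, T.value_empty⟩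

theorem countable_subalgebra : Countable T.subalgebra :=
  (FinitelyDetermined.countable.image T.value).to_subtype

/-- Every nonzero element forces the generic real to be generic over some open set. -/
def IsGeneric : Prop :=
  ∀ b : B, b ≠ ⊥ → ∃ O : Set (ℕ → Bool), IsOpen O ∧ O.Nonempty ∧
    ∀ C ⊆ O, IsOpen C → C.Nonempty → T.value C ⊓ b ≠ ⊥

variable {T}

/-- An atom would lie below the values of two disjoint cylinders, both of which it meets by
genericity. -/
theorem IsGeneric.atomless (hT : T.IsGeneric) : Atomless T.subalgebra := by
  rintro ⟨b, hb⟩ hatom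
  have hne : b ≠ ⊥ := fun h => hatom.1 (Subtype.ext h)
  obtain ⟨C, hC, rfl⟩ := id hb
  obtain ⟨O, hO, ⟨x, hx⟩, hgen⟩ := hT _ hne
  obtain ⟨n, hn⟩ := exists_cylinder_subset hO hx
  obtain ⟨y, hy, z, hz, hyz⟩ := exists_disjoint_cylinders x n
  have hsub : ∀ w ∈ cylinder x n, cylinder w (n + 1) ⊆ O := fun w hw =>
    (cylinder_anti w n.le_succ).trans ((mem_cylinder_iff_eq.1 hw).subset.trans hn)
  have hval : ∀ w ∈ cylinder x n, T.value (cylinder w (n + 1)) ⊓ T.value C = T.value C := by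
    intro w hw
    have hne' := hgen _ (hsub w hw) (isOpen_cylinder _ _ _) ⟨w, self_mem_cylinder _ _⟩
    have hmem : T.value (cylinder w (n + 1)) ⊓ T.value C ∈ T.subalgebra :=
      ⟨_, (FinitelyDetermined.cylinder _ _).inter hC, T.value_inter _ _⟩
    have hle : (⟨_, hmem⟩ : T.subalgebra) ≤ ⟨_, hb⟩ := inf_le_right (α := B)
    rcases hatom.le_iff.1 hle with h | h
    · exact absurd (congrArg Subtype.val h) hne'
    · exact congrArg Subtype.val h
  have h1 := inf_eq_right.1 (hval y hy)
  have h2 := inf_eq_right.1 (hval z hz)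
  refine hne (le_bot_iff.1 ((le_inf h1 h2).trans ?_))
  rw [← T.value_inter, hyz.inter_eq, T.value_empty]

/-- If `u ≠ ⊤` bounds `X` in `B`, take a cylinder inside an open set over which `uᶜ` is generic. No
member of `X` can meet its value, so the complement of that value bounds `X` within the subalgebra.
-/
theorem IsGeneric.regularSubalgebra (hT : T.IsGeneric) : RegularSubalgebra T.subalgebra := by
  intro X hX
  refine ⟨fun _ _ => le_top, fun u hu => ?_⟩
  by_contra hne
  have hu' : uᶜ ≠ ⊥ := fun h => hne (compl_eq_bot.1 h).ge
  obtain ⟨O, hO, ⟨x, hx⟩, hgen⟩ := hT _ hu'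
  obtain ⟨n, hn⟩ := exists_cylinder_subset hO hx
  have hdet := FinitelyDetermined.cylinder x n
  have hmem : (T.value (cylinder x n))ᶜ ∈ T.subalgebra := ⟨_, hdet.compl, T.value_compl hdet⟩
  have hub : (⟨_, hmem⟩ : T.subalgebra) ∈ upperBounds X := by
    rintro ⟨_, C, hC, rfl⟩ hCX
    change T.value C ≤ (T.value (cylinder x n))ᶜ
    rw [le_compl_iff_disjoint_right, disjoint_iff, ← T.value_inter]
    rcases (C ∩ cylinder x n).eq_empty_or_nonempty with h | h
    · rw [h, T.value_empty]
    · refine absurd ?_ (hgen _ (inter_subset_right.trans hn) (hC.inter hdet).isOpen h)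
      have hCu : T.value C ≤ u := hu ⟨_, hCX, rfl⟩
      refine disjoint_iff.1 (disjoint_compl_right.mono_left ?_)
      exact (T.value_mono inter_subset_left).trans hCu
  have htop : (⊤ : B) ≤ (T.value (cylinder x n))ᶜ := hX.2 hub
  refine hgen _ hn (isOpen_cylinder _ _ _) ⟨x, self_mem_cylinder x n⟩ ?_
  rw [compl_eq_top.1 (top_le_iff.1 htop), bot_inf_eq]

end CylinderTree

/-! ### The tree of a `σ`-centered algebra -/

/-- Replaces the tail of `x` from the place `m` on by `y`. -/
def glue (x : ℕ → Bool) (m : ℕ) (y : ℕ → Bool) : ℕ → Bool :=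
  fun i => if i < m then x i else y (i - m)

theorem glue_mem_cylinder (x : ℕ → Bool) (m : ℕ) (y : ℕ → Bool) : glue x m y ∈ cylinder x m :=
  fun i hi => by simp [glue, hi]

theorem glue_add (x : ℕ → Bool) (m : ℕ) (y : ℕ → Bool) (i : ℕ) : glue x m y (i + m) = y i := by
  simp [glue]

theorem glue_shift {x y : ℕ → Bool} {m : ℕ} (hy : y ∈ cylinder x m) :
    glue x m (fun i => y (i + m)) = y := by
  ext i
  by_cases h : i < m
  · simp [glue, h, hy i h]
  · simp [glue, h, Nat.sub_add_cancel (not_lt.1 h)]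

theorem continuous_glue (x : ℕ → Bool) (m : ℕ) : Continuous (glue x m) := by
  refine continuous_pi fun i => ?_
  by_cases h : i < m
  · simpa [glue, h] using continuous_const
  · simpa [glue, h] using continuous_apply (i - m)

section Construction

variable {B : Type u} [CompleteBooleanAlgebra B] (b : B → ℕ → B) (f : B → ℕ → ℕ → Bool)

/-- The nodes obtained by iterating a choice of partitions. -/
def iterNode : List ℕ → B
  | [] => ⊤
  | k :: s => b (iterNode s) k

/-- The labels obtained by iterating a choice of partitions and of sequences in the Cantor
space. -/
def iterLabel : List ℕ → (ℕ → Bool) × ℕ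
  | [] => (fun _ => false, 0)
  -- The summand `k` makes the labels of late successors arbitrarily small, so that they fit inside
  -- a given open set.
  | k :: s => (glue (iterLabel s).1 (iterLabel s).2 (f (iterNode b s) k), (iterLabel s).2 + k + 1)

/-- The tree obtained by iterating a choice of partitions and of sequences. -/
def iterTree (hb : ∀ c, Pairwise (Disjoint on b c)) (hsup : ∀ c, ⨆ k, b c k = c) :
    CylinderTree B where
  node := iterNode b
  pt s := (iterLabel b f s).1
  len s := (iterLabel b f s).2
  node_nil := rfl
  pairwise_disjoint s := hb (iterNode b s)
  iSup_node s := hsup (iterNode b s)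
  pt_mem _ _ := glue_mem_cylinder _ _ _
  len_lt k s := by simp only [iterLabel]; omega

variable {b f} (e : BoundedLatticeHom B (Set ℕ))

/-- Each step down loses the least point, so a node at depth `n + 1` no longer contains the point
`n`. -/
theorem exists_iterNode_of_mem (hsup : ∀ c, ⨆ k, b c k = c)
    (hmin : ∀ c, ∀ n ∈ e c, (∀ m < n, m ∉ e c) → ∀ k, n ∉ e (b c k)) (n : ℕ) :
    ∃ s, n ∈ e (iterNode b s) ∧ ∀ k, n ∉ e (b (iterNode b s) k) := by
  by_contra! hcon
  have key : ∀ j, ∃ s, n ∈ e (iterNode b s) ∧ ∀ m < j, m ∉ e (iterNode b s) := by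
    intro j
    induction j with
    | zero => exact ⟨[], by simp [iterNode], by simp⟩
    | succ j ih =>
      obtain ⟨s, hs, hlt⟩ := ih
      obtain ⟨k, hk⟩ := hcon s hs
      have hle : e (iterNode b (k :: s)) ⊆ e (iterNode b s) :=
        OrderHomClass.mono e ((le_iSup (b (iterNode b s)) k).trans (hsup _).le)
      refine ⟨k :: s, hk, fun m hm hme => ?_⟩
      rcases (Nat.lt_succ_iff_lt_or_eq.1 hm) with h | rfl
      · exact hlt m h (hle hme)
      · exact hmin _ m (hle hme) hlt k hme
  obtain ⟨s, hs, hlt⟩ := key (n + 1)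
  exact hlt n n.lt_succ_self hs

theorem isGeneric_iterTree (he : ∀ b, b ≠ ⊥ → (e b).Nonempty)
    (hb : ∀ c, Pairwise (Disjoint on b c)) (hsup : ∀ c, ⨆ k, b c k = c)
    (hmin : ∀ c, ∀ n ∈ e c, (∀ m < n, m ∉ e c) → ∀ k, n ∉ e (b c k))
    (hf : ∀ c, ∀ n ∈ e c, (∀ k, n ∉ e (b c k)) → ∀ A : Set ℕ, n ∈ e (⨆ k ∈ A, b c k) →
        ¬ IsNowhereDense (f c '' A)) :
    (iterTree b f hb hsup).IsGeneric := by
  intro a ha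
  obtain ⟨n, hn⟩ := he a ha
  obtain ⟨s, hs, hsk⟩ := exists_iterNode_of_mem e hsup hmin n
  set c := iterNode b s with hc
  set x := (iterLabel b f s).1 with hx
  set m := (iterLabel b f s).2 with hm
  -- The pieces meeting `a` cover `c ⊓ a`, which contains the point `n`; hence `A` has somewhere
  -- dense image.
  let A : Set ℕ := {k | b c k ⊓ a ≠ ⊥}
  have hA : n ∈ e (⨆ k ∈ A, b c k) := by
    have h1 : n ∈ e (c ⊓ a) := by rw [map_inf]; exact ⟨hs, hn⟩
    refine OrderHomClass.mono e ?_ h1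
    rw [← hsup c, iSup_inf_eq]
    refine iSup_le fun k => ?_
    rw [hsup c]
    by_cases hk : k ∈ A
    · exact inf_le_left.trans (le_biSup (b c) hk)
    · exact (not_not.1 hk).trans_le bot_le
  obtain ⟨v, hv⟩ := nonempty_iff_ne_empty.2 (hf c n hs hsk A hA)
  have hshift : Continuous fun (y : ℕ → Bool) (i : ℕ) => y (i + m) :=
    continuous_pi fun i => continuous_apply (i + m)
  refine ⟨cylinder x m ∩ (fun y i => y (i + m)) ⁻¹' interior (closure (f c '' A)),
    (isOpen_cylinder _ x m).inter (isOpen_interior.preimage hshift),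
    ⟨glue x m v, glue_mem_cylinder x m v, by simpa [glue_add] using hv⟩, ?_⟩
  rintro C hCO hC ⟨y, hy⟩
  have hyC : (fun i => y (i + m)) ∈ glue x m ⁻¹' C := by
    rw [mem_preimage, glue_shift (hCO hy).1]
    exact hy
  obtain ⟨l, hl⟩ := exists_cylinder_subset (hC.preimage (continuous_glue x m)) hyC
  obtain ⟨k, hkA, hlk, hk⟩ := exists_mem_cylinder_of_subset_closure (f := f c) (A := A)
    (fun z hz => by
      have := (hCO (hl hz)).2
      simp only [mem_preimage, glue_add] at this
      exact interior_subset this)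
  have hsub : (iterTree b f hb hsup).cyl (k :: s) ⊆ C := by
    intro z hz
    have hz' : ∀ i < m + k + 1, z i = glue x m (f c k) i := hz
    have hzx : z ∈ cylinder x m := fun i hi => by
      rw [hz' i (by omega)]; exact glue_mem_cylinder x m _ i hi
    rw [← glue_shift hzx]
    refine hl fun i hi => ?_
    rw [hz' (i + m) (by omega), glue_add]
    exact hk i hi
  intro hbot
  exact hkA (le_bot_iff.1 ((inf_le_inf_right a
    ((iterTree b f hb hsup).node_le_value hsub)).trans hbot.le))

end Construction

theorem exists_countable_atomless_regular_subalgebra {B : Type u} [CompleteBooleanAlgebra B]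
    [Nontrivial B] (hB : Atomless B) (hσ : SigmaCentered B)
    (hU : ∀ U : Ultrafilter ℕ, (∀ n, U ≠ pure n) → ¬ NowhereDenseFilter (U : Filter ℕ)) :
    ∃ S : BooleanSubalgebra B, Countable S ∧ Atomless S ∧ RegularSubalgebra S := by
  obtain ⟨e, he⟩ := hσ.exists_hom
  choose b f hb hsup hmin hf using exists_partition_not_nowhereDense e hB he hU
  have hT := isGeneric_iterTree e he hb hsup hmin hf
  exact ⟨_, CylinderTree.countable_subalgebra _, hT.atomless, hT.regularSubalgebra⟩

/-! ### Dyadic schemes in countable atomless algebras -/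

theorem Atomless.exists_split {S : Type*} [BooleanAlgebra S] (hS : Atomless S) {a : S} (ha : a ≠ ⊥)
    (c : S) : ∃ a', a' ≠ ⊥ ∧ a \ a' ≠ ⊥ ∧ a' ≤ a ∧ (a ⊓ c ≠ ⊥ → a' ≤ c) := by
  by_cases h : a ⊓ c ≠ ⊥ ∧ a \ c ≠ ⊥
  · exact ⟨a ⊓ c, h.1, by rw [sdiff_inf_self_left]; exact h.2, inf_le_left, fun _ => inf_le_right⟩
  · obtain ⟨a', hlt, hne⟩ : ∃ a' < a, a' ≠ ⊥ := by
      by_contra! hcon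
      exact hS a ⟨ha, hcon⟩
    refine ⟨a', hne, fun h0 => hlt.not_ge (sdiff_eq_bot_iff.1 h0), hlt.le, fun hac => ?_⟩
    have : a \ c = ⊥ := by
      by_contra h'
      exact h ⟨hac, h'⟩
    exact hlt.le.trans (sdiff_eq_bot_iff.1 this)

/-- A countable atomless algebra has a dense subset indexed by the finite binary sequences, each
member being split by its two successors. -/
theorem Atomless.exists_dyadic_scheme {S : Type*} [BooleanAlgebra S] [Nontrivial S] [Countable S]
    (hS : Atomless S) :
    ∃ a : List Bool → S, a [] = ⊤ ∧ (∀ σ, a σ ≠ ⊥) ∧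
      (∀ σ, a (true :: σ) ⊔ a (false :: σ) = a σ) ∧
      (∀ σ, Disjoint (a (true :: σ)) (a (false :: σ))) ∧ ∀ c, c ≠ ⊥ → ∃ σ, a σ ≤ c := by
  obtain ⟨en, hen⟩ := exists_surjective_nat S
  choose sp h1 h2 h3 h4 using fun (a : {a : S // a ≠ ⊥}) (c : S) => hS.exists_split a.2 c
  -- Level `n` is split according to the `n`-th element: a member meeting it gets its `true` half
  -- below it. This yields density.
  let a : List Bool → {a : S // a ≠ ⊥} := fun σ =>
    List.rec ⟨⊤, top_ne_bot⟩ (fun b σ p => bif b then ⟨sp p (en σ.length), h1 _ _⟩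
      else ⟨p.1 \ sp p (en σ.length), h2 _ _⟩) σ
  have ht : ∀ σ, (a (true :: σ)).1 = sp (a σ) (en σ.length) := fun σ => rfl
  have hf : ∀ σ, (a (false :: σ)).1 = (a σ).1 \ sp (a σ) (en σ.length) := fun σ => rfl
  have hsup : ∀ σ, (a (true :: σ)).1 ⊔ (a (false :: σ)).1 = (a σ).1 := fun σ => by
    rw [ht, hf]; exact sup_sdiff_cancel_right (h3 _ _)
  refine ⟨fun σ => (a σ).1, rfl, fun σ => (a σ).2, hsup,
    fun σ => disjoint_sdiff_self_right, fun c hc => ?_⟩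
  have hcov : ∀ n, ∃ σ : List Bool, σ.length = n ∧ (a σ).1 ⊓ c ≠ ⊥ := by
    intro n
    induction n with
    | zero => exact ⟨[], rfl, by simpa [a] using hc⟩
    | succ n ih =>
      obtain ⟨σ, hσ, hne⟩ := ih
      rw [← hsup σ, inf_sup_right] at hne
      by_cases h : (a (true :: σ)).1 ⊓ c = ⊥
      · rw [h, bot_sup_eq] at hne
        exact ⟨false :: σ, by simp [hσ], hne⟩
      · exact ⟨true :: σ, by simp [hσ], h⟩
  obtain ⟨n, rfl⟩ := hen c
  obtain ⟨σ, rfl, hne⟩ := hcov n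
  exact ⟨true :: σ, h4 _ _ hne⟩

theorem exists_res_eq (σ : List Bool) : ∃ x : ℕ → Bool, res x σ.length = σ := by
  induction σ with
  | nil => exact ⟨fun _ => false, rfl⟩
  | cons b σ ih =>
    obtain ⟨x, hx⟩ := ih
    refine ⟨update x σ.length b, ?_⟩
    rw [List.length_cons, res_succ, update_self]
    congr 1
    rw [← hx, res_length, res_eq_res]
    intro m hm
    rw [update_of_ne hm.ne]

theorem exists_branch {P : List Bool → Prop} (h0 : P [])
    (hs : ∀ σ, P σ → P (true :: σ) ∨ P (false :: σ)) : ∃ x : ℕ → Bool, ∀ n, P (res x n) := by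
  have : ∀ σ : {σ // P σ}, ∃ b : Bool, P (b :: σ) := fun σ => by
    rcases hs σ σ.2 with h | h
    exacts [⟨_, h⟩, ⟨_, h⟩]
  choose b hb using this
  let L : ℕ → {σ // P σ} := fun n => Nat.rec ⟨[], h0⟩ (fun _ σ => ⟨b σ :: σ, hb σ⟩) n
  have hL : ∀ n, res (fun n => b (L n)) n = (L n).1 := by
    intro n
    induction n with
    | zero => rfl
    | succ n ih => rw [res_succ, ih]
  exact ⟨_, fun n => by rw [hL]; exact (L n).2⟩

/-! ### More on nowhere dense sets -/

theorem isNowhereDense_singleton_cantor (x : ℕ → Bool) : IsNowhereDense {x} := by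
  rw [isNowhereDense_iff_cylinder]
  intro y n
  obtain ⟨z, hz, w, hw, hd⟩ := exists_disjoint_cylinders y n
  by_cases h : x ∈ cylinder z (n + 1)
  · exact ⟨w, n + 1, n.le_succ, hw, disjoint_singleton_left.2 (disjoint_left.1 hd h)⟩
  · exact ⟨z, n + 1, n.le_succ, hz, disjoint_singleton_left.2 h⟩

theorem isNowhereDense_union_cantor {F G : Set (ℕ → Bool)} (hF : IsNowhereDense F)
    (hG : IsNowhereDense G) : IsNowhereDense (F ∪ G) := by
  rw [isNowhereDense_iff_cylinder] at *
  intro x n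
  obtain ⟨y, m, hnm, hy, hd⟩ := hF x n
  obtain ⟨z, l, hml, hz, hd'⟩ := hG y m
  refine ⟨z, l, hnm.trans hml, ?_, disjoint_union_left.2 ⟨hd.mono_right ?_, hd'⟩⟩
  · rw [← mem_cylinder_iff_eq.1 hy]
    exact cylinder_anti y hnm hz
  · rw [← mem_cylinder_iff_eq.1 hz]
    exact cylinder_anti z hml

theorem isNowhereDense_biUnion_cantor {ι : Type*} {I : Set ι} (hI : I.Finite)
    {F : ι → Set (ℕ → Bool)} (hF : ∀ i ∈ I, IsNowhereDense (F i)) :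
    IsNowhereDense (⋃ i ∈ I, F i) := by
  induction I, hI using Set.Finite.induction_on with
  | empty => simp
  | insert _ _ ih =>
    rw [biUnion_insert]
    exact isNowhereDense_union_cantor (hF _ (mem_insert _ _))
      (ih fun i hi => hF i (mem_insert_of_mem _ hi))

/-! ### Trees branching along an ultrafilter -/

section Tree

variable {α : Type u}

/-- The sequences, listed from the last entry to the first, all of whose entries are permitted
by `A`. -/
def permittedTree (A : List α → Set α) : Set (List α)
  | [] => True
  | a :: s => permittedTree A s ∧ a ∈ A s

/-- Inside a cylinder of length `m` missing level `k`, only the finitely many parents with code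
below `m` can have children, and these are avoided by shrinking. Any other child agrees with its
parent up to `m`. -/
theorem isNowhereDense_image_level {g : List α → ℕ → Bool} {A : List α → Set α}
    {code : List α → ℕ} (hcode : Injective code)
    (hA : ∀ s, IsNowhereDense ((fun a => g (a :: s)) '' A s))
    (hclose : ∀ s, ∀ a ∈ A s, g (a :: s) ∈ cylinder (g s) (code s)) (k : ℕ) :
    IsNowhereDense (g '' {s | s ∈ permittedTree A ∧ s.length = k}) := by
  induction k with
  | zero =>
    refine (isNowhereDense_singleton_cantor (g [])).mono ?_
    rintro _ ⟨s, ⟨-, hs⟩, rfl⟩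
    rw [List.length_eq_zero_iff.1 hs]
    rfl
  | succ k ih =>
    rw [isNowhereDense_iff_cylinder]
    intro x n
    obtain ⟨y, m, hnm, hy, hd⟩ := isNowhereDense_iff_cylinder.1 ih x n
    have hfin : {s | code s < m}.Finite := (finite_lt_nat m).preimage hcode.injOn
    obtain ⟨z, l, hml, hz, hd'⟩ := isNowhereDense_iff_cylinder.1
      (isNowhereDense_biUnion_cantor hfin fun s _ => hA s) y m
    have hzy : cylinder z l ⊆ cylinder y m :=
      (cylinder_anti z hml).trans (mem_cylinder_iff_eq.1 hz).subset
    refine ⟨z, l, hnm.trans hml, ?_, disjoint_left.2 ?_⟩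
    · rw [← mem_cylinder_iff_eq.1 hy]
      exact cylinder_anti y hnm hz
    rintro _ ⟨s, ⟨hs, hl⟩, rfl⟩ hgs
    cases s with
    | nil => simp at hl
    | cons a s =>
      by_cases hlt : code s < m
      · exact disjoint_left.1 hd' (mem_biUnion hlt ⟨a, hs.2, rfl⟩) hgs
      · refine disjoint_left.1 hd ⟨s, ⟨hs.1, by simpa using hl⟩, rfl⟩ ?_
        have h1 := cylinder_anti _ (not_lt.1 hlt) (hclose s a hs.2)
        rw [← mem_cylinder_iff_eq.1 (hzy hgs)]
        exact (mem_cylinder_comm _ _ _).1 h1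

/-- A map to the Cantor space that is continuous along a nowhere dense ultrafilter is nowhere dense
on some open set of nodes. -/
theorem exists_open_isNowhereDense_image [Countable α] {U : Ultrafilter α}
    (hU : ∀ f : α → ℕ → Bool, ∃ A ∈ U, IsNowhereDense (f '' A)) {g : List α → ℕ → Bool}
    (hg : ∀ s n, ∀ᶠ a in (U : Filter α), g (a :: s) ∈ cylinder (g s) n) :
    ∃ W : Set (List α), [] ∈ W ∧ (∀ s ∈ W, ∀ᶠ a in (U : Filter α), a :: s ∈ W) ∧
      IsNowhereDense (g '' W) := by
  obtain ⟨code, hcode⟩ := exists_injective_nat (List α)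
  have hex : ∀ s, ∃ A ∈ U, IsNowhereDense ((fun a => g (a :: s)) '' A) ∧
      ∀ a ∈ A, g (a :: s) ∈ cylinder (g s) (code s) := by
    intro s
    obtain ⟨A, hA, hnd⟩ := hU fun a => g (a :: s)
    exact ⟨A ∩ {a | g (a :: s) ∈ cylinder (g s) (code s)}, Filter.inter_mem hA (hg s (code s)),
      hnd.mono (image_mono inter_subset_left), fun a ha => ha.2⟩
  choose A hAU hA hclose using hex
  have hlevel : ∀ k, IsNowhereDense (g '' {s | s ∈ permittedTree A ∧ s.length ≤ k}) := by
    intro k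
    refine (isNowhereDense_biUnion_cantor (finite_le_nat k) fun j _ =>
      isNowhereDense_image_level hcode hA hclose j).mono ?_
    rintro _ ⟨s, ⟨hs, hk⟩, rfl⟩
    exact mem_biUnion (x := s.length) hk ⟨s, ⟨hs, rfl⟩, rfl⟩
  obtain ⟨q, hq⟩ := TopologicalSpace.exists_dense_seq (ℕ → Bool)
  choose y m hnm hy hd using fun k : ℕ =>
    isNowhereDense_iff_cylinder.1 (hlevel k) (q k.unpair.1) k.unpair.2
  have havoid : ∀ s ∈ permittedTree A, ∀ k, s.length ≤ k → g s ∉ cylinder (y k) (m k) :=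
    fun s hs k hk => disjoint_left.1 (hd k) ⟨s, ⟨hs, hk⟩, rfl⟩
  -- The removed cylinders are dense. The `k`-th misses all levels up to `k`, so at each node only
  -- finitely many matter for its successors, and continuity handles those.
  refine ⟨{s | s ∈ permittedTree A ∧ ∀ k, g s ∉ cylinder (y k) (m k)},
    ⟨trivial, fun k => havoid [] trivial k (Nat.zero_le k)⟩, ?_, ?_⟩
  · rintro s ⟨hs, hsk⟩
    have hev : ∀ᶠ a in (U : Filter α), ∀ k ∈ {k | k ≤ s.length},
        g (a :: s) ∉ cylinder (y k) (m k) := by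
      refine (Filter.eventually_all_finite (finite_le_nat s.length)).2 fun k _ => ?_
      filter_upwards [hg s (m k)] with a ha hmem
      refine hsk k ?_
      rw [← mem_cylinder_iff_eq.1 hmem]
      exact (mem_cylinder_comm _ _ _).1 ha
    filter_upwards [hAU s, hev] with a ha hak
    refine ⟨⟨hs, ha⟩, fun k => ?_⟩
    by_cases hk : k ≤ s.length
    · exact hak k hk
    · exact havoid (a :: s) ⟨hs, ha⟩ k (by rw [List.length_cons]; omega)
  · rw [isNowhereDense_iff_cylinder]
    intro x n
    obtain ⟨i, hi⟩ := hq.exists_mem_open (isOpen_cylinder _ x n) ⟨x, self_mem_cylinder x n⟩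
    refine ⟨y (Nat.pair i n), m (Nat.pair i n), ?_, ?_, ?_⟩
    · simpa using hnm (Nat.pair i n)
    · have := hy (Nat.pair i n)
      rw [Nat.unpair_pair] at this
      rwa [← mem_cylinder_iff_eq.1 hi]
    · rw [disjoint_left]
      rintro _ ⟨s, hs, rfl⟩
      exact hs.2 _

/-! ### The clopen algebra and its completeness -/

variable (U : Ultrafilter α)

/-- The algebra of the clopen sets of finite sequences, in the topology whose open sets contain
with each node `U`-almost all of its immediate successors. -/
def treeAlgebra : BooleanSubalgebra (Set (List α)) where
  carrier := {C | ∀ s, s ∈ C ↔ ∀ᶠ a in (U : Filter α), a :: s ∈ C}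
  supClosed' := fun C hC C' hC' s => by
    change s ∈ C ∨ s ∈ C' ↔ ∀ᶠ a in (U : Filter α), a :: s ∈ C ∨ a :: s ∈ C'
    rw [Ultrafilter.eventually_or, ← hC, ← hC']
  infClosed' := fun C hC C' hC' s => by
    change s ∈ C ∧ s ∈ C' ↔ ∀ᶠ a in (U : Filter α), a :: s ∈ C ∧ a :: s ∈ C'
    rw [Filter.eventually_and, ← hC, ← hC']
  compl_mem' := fun {C} hC s => by
    change s ∉ C ↔ ∀ᶠ a in (U : Filter α), a :: s ∉ C
    rw [Ultrafilter.eventually_not, ← hC]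
  bot_mem' := fun s => by simp [U.neBot.ne]

variable {U}

theorem mem_treeAlgebra {C : Set (List α)} :
    C ∈ treeAlgebra U ↔ ∀ s, s ∈ C ↔ ∀ᶠ a in (U : Filter α), a :: s ∈ C :=
  Iff.rfl

/-- The largest open set of nodes disjoint from all members of `X`. -/
def openPolar (X : Set (treeAlgebra U)) : Set (List α) :=
  {s | ∃ W : Set (List α), s ∈ W ∧ (∀ t ∈ W, ∀ᶠ a in (U : Filter α), a :: t ∈ W) ∧
    ∀ C ∈ X, Disjoint W (C : Set (List α))}

/-- This is extremal disconnectedness: a node with almost all successors in the polar can be added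
to it, since a clopen `C` containing the node would contain one of those successors. -/
theorem openPolar_mem (X : Set (treeAlgebra U)) : openPolar X ∈ treeAlgebra U := by
  refine mem_treeAlgebra.2 fun s => ⟨?_, fun h => ?_⟩
  · rintro ⟨W, hs, hW, hX⟩
    exact (hW s hs).mono fun a ha => ⟨W, ha, hW, hX⟩
  · refine ⟨insert s (openPolar X), mem_insert _ _, ?_, fun C hC => ?_⟩
    · rintro t (rfl | ⟨W, ht, hW, hX⟩)
      · exact h.mono fun a ha => mem_insert_of_mem _ ha
      · exact (hW t ht).mono fun a ha => mem_insert_of_mem _ ⟨W, ha, hW, hX⟩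
    · have hdis : ∀ t ∈ openPolar X, t ∉ (C : Set (List α)) := by
        rintro t ⟨W, ht, -, hX⟩
        exact disjoint_left.1 (hX C hC) ht
      refine disjoint_left.2 ?_
      rintro t (rfl | ht)
      · intro htC
        obtain ⟨a, ha, ha'⟩ := (h.and ((mem_treeAlgebra.1 C.2 t).1 htC)).exists
        exact hdis _ ha ha'
      · exact hdis t ht

theorem isLUB_compl_openPolar (X : Set (treeAlgebra U)) :
    IsLUB X (⟨openPolar X, openPolar_mem X⟩ᶜ : treeAlgebra U) := by
  constructor
  · rintro C hC s hs ⟨W, hsW, -, hX⟩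
    exact disjoint_left.1 (hX C hC) hsW hs
  · intro C hC s hs
    by_contra hsC
    refine hs ⟨(C : Set (List α))ᶜ, hsC, fun t ht => ?_, fun C' hC' => ?_⟩
    · exact (mem_treeAlgebra.1 (Cᶜ : treeAlgebra U).2 t).1 ht
    · exact disjoint_compl_left.mono_right (hC hC')

noncomputable instance : CompleteBooleanAlgebra (treeAlgebra U) :=
  { (inferInstance : BooleanAlgebra (treeAlgebra U)) with
    sSup := fun X => ⟨openPolar X, openPolar_mem X⟩ᶜ
    sInf := fun X => ⟨openPolar (lowerBounds X), openPolar_mem (lowerBounds X)⟩ᶜ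
    isLUB_sSup := isLUB_compl_openPolar
    isGLB_sInf := fun X => isLUB_lowerBounds.1 (isLUB_compl_openPolar (lowerBounds X)) }

end Tree

/-! ### Properties of the clopen algebra -/

section TreeAlgebra

variable {α : Type u} {U : Ultrafilter α}

instance : Nontrivial (treeAlgebra U) :=
  ⟨⊥, ⊤, fun h => by
    have : ([] : List α) ∈ ((⊥ : treeAlgebra U) : Set (List α)) := by rw [h]; trivial
    exact this⟩

theorem sigmaCentered_treeAlgebra [Countable α] : SigmaCentered (treeAlgebra U) := by
  obtain ⟨q, hq⟩ := exists_surjective_nat (List α)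
  refine ⟨fun n => {C | q n ∈ (C : Set (List α))}, ?_, ?_⟩
  · ext C
    simp only [mem_iUnion, mem_ofPred_eq]
    constructor
    · rintro ⟨n, hn⟩ rfl
      exact hn
    · intro hC
      obtain ⟨s, hs⟩ := nonempty_iff_ne_empty.2 fun h => hC (Subtype.ext h)
      obtain ⟨n, rfl⟩ := hq s
      exact ⟨n, hs⟩
  · intro n C hC C' hC'
    exact ⟨C ⊓ C', ⟨hC, hC'⟩, inf_le_left (a := C), inf_le_right (a := C)⟩

theorem Ultrafilter.eventually_ne_of_ne_pure (hU : ∀ a, U ≠ pure a) (a : α) :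
    ∀ᶠ b in (U : Filter α), b ≠ a := by
  rw [Ultrafilter.eventually_not]
  exact fun h => hU a (Ultrafilter.coe_injective (U.neBot.eq_pure_iff.2 h))

/-- A node outside the cone has at most one successor in it, and singletons are not in `U`. -/
theorem cone_mem_treeAlgebra (hU : ∀ a, U ≠ pure a) (t : List α) :
    {s | t <:+ s} ∈ treeAlgebra U := by
  refine mem_treeAlgebra.2 fun s => ⟨fun h => ?_, fun h => ?_⟩
  · exact Filter.Eventually.of_forall fun a => h.trans (List.suffix_cons a s)
  · by_contra hs
    have heq : ∀ᶠ a in (U : Filter α), a :: s = t := h.mono fun a ha =>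
      ((List.suffix_cons_iff.1 ha).resolve_right hs).symm
    obtain ⟨a, ha⟩ := heq.exists
    obtain ⟨b, hb, hba⟩ := (heq.and (Ultrafilter.eventually_ne_of_ne_pure hU a)).exists
    exact hba (List.cons_eq_cons.1 (hb.trans ha.symm)).1

theorem atomless_treeAlgebra (hU : ∀ a, U ≠ pure a) : Atomless (treeAlgebra U) := by
  intro C hC
  obtain ⟨s, hs⟩ := nonempty_iff_ne_empty.2 fun h => hC.1 (Subtype.ext h)
  have hev := (mem_treeAlgebra.1 C.2 s).1 hs
  obtain ⟨a, ha⟩ := hev.exists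
  obtain ⟨b, hb, hba⟩ := (hev.and (Ultrafilter.eventually_ne_of_ne_pure hU a)).exists
  have hle : C ⊓ ⟨_, cone_mem_treeAlgebra hU (a :: s)⟩ ≤ C := inf_le_left
  have hmem : a :: s ∈ ((C ⊓ ⟨_, cone_mem_treeAlgebra hU (a :: s)⟩ : treeAlgebra U) :
      Set (List α)) := ⟨ha, List.suffix_rfl⟩
  rcases hC.le_iff.1 hle with h | h
  · rw [h] at hmem
    exact hmem
  · have hbs : b :: s ∈ ((C ⊓ ⟨_, cone_mem_treeAlgebra hU (a :: s)⟩ : treeAlgebra U) :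
        Set (List α)) := by rw [h]; exact hb
    have : a :: s = b :: s := List.IsSuffix.eq_of_length hbs.2 (by simp)
    exact hba (List.cons_eq_cons.1 this).1.symm

theorem not_exists_regularSubalgebra_treeAlgebra [Countable α]
    (hU : ∀ f : α → ℕ → Bool, ∃ A ∈ U, IsNowhereDense (f '' A)) :
    ¬ ∃ S : BooleanSubalgebra (treeAlgebra U),
      Countable S ∧ Atomless S ∧ RegularSubalgebra S := by
  rintro ⟨S, hScount, hS, hreg⟩
  have : Nontrivial S := ⟨⊥, ⊤, fun h => bot_ne_top (congrArg Subtype.val h)⟩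
  obtain ⟨a, hnil, hne, hsup, hdisj, hdense⟩ := hS.exists_dyadic_scheme
  let E : S → Set (List α) := fun c => ((c : treeAlgebra U) : Set (List α))
  have hEinf : ∀ c d : S, E (c ⊓ d) = E c ∩ E d := fun _ _ => rfl
  have hEbot : E ⊥ = ∅ := rfl
  have hEmono : ∀ {c d : S}, c ≤ d → E c ⊆ E d := fun h => h
  have hanti : ∀ b σ, a (b :: σ) ≤ a σ := by
    intro b σ
    rw [← hsup σ]
    cases b
    exacts [le_sup_right, le_sup_left]
  have hbranch : ∀ s, ∃ x : ℕ → Bool, ∀ n, s ∈ E (a (res x n)) := fun s =>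
    exists_branch (P := fun σ => s ∈ E (a σ)) (by rw [hnil]; trivial) fun σ hσ => by
      rwa [← hsup σ] at hσ
  -- The real `g s` is the branch of the scheme whose members all contain `s`.
  choose g hg using hbranch
  have hgcyl : ∀ s y n, s ∈ E (a (res y n)) → res y n = res (g s) n := by
    intro s y n
    induction n with
    | zero => exact fun _ => rfl
    | succ n ih =>
      intro h
      have hres := ih (hEmono (hanti _ _) h)
      have hgs := hg s (n + 1)
      rw [res_succ] at h hgs
      rw [res_succ, res_succ, hres]
      rw [hres] at h
      have hd : E (a (true :: res (g s) n)) ∩ E (a (false :: res (g s) n)) = ∅ := by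
        rw [← hEinf, (hdisj _).eq_bot, hEbot]
      congr 1
      cases hy : y n <;> cases hx : g s n <;> rw [hy] at h <;> rw [hx] at hgs
      · exact absurd (hd.subset ⟨hgs, h⟩) (notMem_empty _)
      · exact absurd (hd.subset ⟨h, hgs⟩) (notMem_empty _)
  have hcyl : ∀ s y n, s ∈ E (a (res y n)) → g s ∈ cylinder y n := fun s y n h => by
    rw [cylinder_eq_res]
    exact (hgcyl s y n h).symm
  have hcont : ∀ s n, ∀ᶠ b in (U : Filter α), g (b :: s) ∈ cylinder (g s) n := fun s n =>
    ((mem_treeAlgebra.1 (a (res (g s) n) : treeAlgebra U).2 s).1 (hg s n)).mono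
      fun b hb => hcyl _ _ _ hb
  obtain ⟨W, hnilW, hW, hnd⟩ := exists_open_isNowhereDense_image hU hcont
  rw [isNowhereDense_iff_cylinder] at hnd
  let X : Set S := {c | Disjoint W (E c)}
  have hX : IsLUB X ⊤ := by
    refine ⟨fun _ _ => le_top, fun u hu => ?_⟩
    by_contra hcon
    obtain ⟨σ, hσ⟩ := hdense uᶜ fun h => hcon (compl_eq_bot.1 h).ge
    obtain ⟨x, hx⟩ := exists_res_eq σ
    obtain ⟨y, m, hnm, hy, hd⟩ := hnd x σ.length
    have hmem : a (res y m) ∈ X := disjoint_left.2 fun s hs hsa =>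
      disjoint_left.1 hd ⟨s, hs, rfl⟩ (hcyl s y m hsa)
    have hle : a (res y m) ≤ a σ := by
      have hyx : res y σ.length = σ := by
        rw [cylinder_eq_res] at hy
        exact hy.trans hx
      have : ∀ k, a (res y (σ.length + k)) ≤ a σ := by
        intro k
        induction k with
        | zero => rw [Nat.add_zero, hyx]
        | succ k ih => exact (hanti _ _).trans ih
      have := this (m - σ.length)
      rwa [Nat.add_sub_cancel' hnm] at this
    exact hne _ (le_bot_iff.1 ((le_inf (hu hmem) (hle.trans hσ)).trans (inf_compl_self u).le))
  have hlub := hreg X hX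
  have heq := hlub.unique (isLUB_compl_openPolar _)
  have : ([] : List α) ∈ ((⊤ : treeAlgebra U) : Set (List α)) := trivial
  rw [heq] at this
  refine this ⟨W, hnilW, hW, ?_⟩
  rintro _ ⟨c, hc, rfl⟩
  exact hc

end TreeAlgebra

theorem theorem1 :
    (∃ (B : Type u) (_ : CompleteBooleanAlgebra B),
      Nontrivial B ∧ Atomless B ∧ SigmaCentered B ∧
        ¬ ∃ S : BooleanSubalgebra B, Countable S ∧ Atomless S ∧ RegularSubalgebra S) ↔
    ∃ U : Ultrafilter ℕ, (∀ n : ℕ, U ≠ pure n) ∧ NowhereDenseFilter (U : Filter ℕ) := by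
  constructor
  · rintro ⟨B, _, _, hB, hσ, hS⟩
    by_contra! hU
    exact hS (exists_countable_atomless_regular_subalgebra hB hσ hU)
  · rintro ⟨U, hU, hnd⟩
    -- Lifting the index set places the algebra in universe `u`.
    let V : Ultrafilter (ULift.{u} ℕ) := U.map ULift.up
    have hV : ∀ a, V ≠ pure a := by
      intro a ha
      have := congrArg (Ultrafilter.map ULift.down) ha
      rw [Ultrafilter.map_map, Ultrafilter.map_pure] at this
      exact hU a.down ((Ultrafilter.map_id U).symm.trans this)
    refine ⟨treeAlgebra V, inferInstance, inferInstance, atomless_treeAlgebra hV,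
      sigmaCentered_treeAlgebra, not_exists_regularSubalgebra_treeAlgebra fun f => ?_⟩
    obtain ⟨A, hA, hfA⟩ := hnd (f ∘ ULift.up)
    refine ⟨ULift.up '' A, Filter.image_mem_map hA, ?_⟩
    rwa [← image_comp]
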